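/- Let $U_1, U_2, \dots$ be independent random variables, each uniformly distributed on $[0,1]$. Break the stick $[0,1]$ successively at the points $U_1, U_2, \dots$, so that after $n$ breaks there are $n+1$ pieces. Let $X$ be the least $n$ such that, after $n$ breaks, some three of the $n+1$ pieces are the side lengths of a (nondegenerate) triangle, with $X = \infty$ if there is no such $n$. Then $X$ is a random variable and $\mathbb{E}[X] \le 3.398$. -/

import Mathlib

open MeasureTheory ProbabilityTheory

/-- Three lengths are the side lengths of a (nondegenerate) triangle. -/
def IsTriangle (a b c : ℝ) : Prop :=
  a < b + c ∧ b < c + a ∧ c < a + b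

/-- The breakpoints `x 0, …, x (n - 1)` listed in increasing order. -/
noncomputable def sortedBreaks {n : ℕ} (x : Fin n → ℝ) : Fin n → ℝ :=
  x ∘ Tuple.sort x

/-- The lengths, from left to right, of the `n + 1` pieces into which the stick `[0, 1]` is cut by
the breakpoints `x 0, …, x (n - 1)`: with sorted breakpoints `y 0 ≤ … ≤ y (n - 1)` these are
`y 0 - 0, y 1 - y 0, …, y (n - 1) - y (n - 2), 1 - y (n - 1)`. -/
noncomputable def pieceLength {n : ℕ} (x : Fin n → ℝ) (i : Fin (n + 1)) : ℝ :=
  (Fin.snoc (sortedBreaks x) 1 : Fin (n + 1) → ℝ) i -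
    (Fin.cons 0 (sortedBreaks x) : Fin (n + 1) → ℝ) i

/-- Some three of the pieces cut off by the given breakpoints form a triangle. -/
def SomeThreeFormTriangle {n : ℕ} (x : Fin n → ℝ) : Prop :=
  ∃ i j k : Fin (n + 1), i ≠ j ∧ i ≠ k ∧ j ≠ k ∧
    IsTriangle (pieceLength x i) (pieceLength x j) (pieceLength x k)

/-- For a sequence `u 0, u 1, …` of successive breakpoints, the least number `n` of breaks after
which some three of the pieces form a triangle (`⊤` if there is no such `n`). -/
noncomputable def breaksUntilTriangle (u : ℕ → ℝ) : ℕ∞ :=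
  ⨅ (n : ℕ) (_ : SomeThreeFormTriangle (fun i : Fin n => u i)), (n : ℕ∞)

open scoped Pointwise

/-! Write the expectation as the sum over `m` of P(X > m), and bound each tail by a volume in the
cube. Sorted lengths of `n + 1` pieces, no three of which form a triangle, satisfy ℓ_k ≥ ℓ_{k-1} +
ℓ_{k-2}. The slacks in these inequalities are unimodular coordinates in which the total length 1 is
a positive combination with weights `c k` (Fibonacci numbers minus one), so each ordering of breaks
and pieces gives a simplex of volume at most 1 / (n! ∏ c) (`volume_gaps_le`). Summing over the n!
(n+1)! orderings bounds P(X > n) by (n+1)! / ∏ (F_{j+3} - 1) (`volume_no_triangle_le`).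

These bounds alone sum to about 3.424. The term `m = 3` is improved from 3/7 to 45/112 by also using
that no triangle existed after two breaks (`half_le_gap`, `volume_no_triangle_two_three_le`). From
`m = 8` on the bounds are dominated by a geometric series. -/

/-! ### Volume of a simplex from an exponential integral. -/

theorem lintegral_fin_prod_eq_prod (n : ℕ) (f : Fin n → ℝ → ENNReal)
    (hf : ∀ i, Measurable (f i)) :
    ∫⁻ x : Fin n → ℝ, ∏ i, f i (x i) = ∏ i, ∫⁻ t, f i t := by
  induction n with
  | zero => simp [lintegral_unique, volume_pi]
  | succ n ih =>
    have e := (volume_preserving_piFinSuccAbove (fun _ : Fin (n + 1) => ℝ) 0).symm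
    rw [← e.lintegral_comp (f := fun x => ∏ i, f i (x i)) (Finset.measurable_prod _ fun i _ =>
        (hf i).comp (measurable_pi_apply i)), Fin.prod_univ_succ,
      ← ih (fun i => f i.succ) (fun i => hf _),
      ← lintegral_prod_mul (hf 0).aemeasurable (Finset.measurable_prod _ fun i _ =>
        (hf i.succ).comp (measurable_pi_apply i)).aemeasurable]
    refine lintegral_congr fun z => ?_
    simp [MeasurableEquiv.piFinSuccAbove, Fin.prod_univ_succ]

theorem lintegral_indicator_exp_neg_mul {c : ℝ} (hc : 0 < c) :
    ∫⁻ t : ℝ, (Set.Ici (0 : ℝ)).indicator (fun t => ENNReal.ofReal (Real.exp (-(c * t)))) t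
      = ENNReal.ofReal (1 / c) := by
  rw [lintegral_indicator measurableSet_Ici, setLIntegral_congr Ioi_ae_eq_Ici.symm,
    ← ofReal_integral_eq_lintegral_ofReal]
  · congr 1
    have := integral_exp_mul_Ioi (a := -c) (by linarith) 0
    simp only [neg_mul] at this
    rw [this]; simp
  · have := integrableOn_exp_mul_Ioi (a := -c) (by linarith) 0
    simp only [neg_mul] at this
    exact this
  · exact Filter.Eventually.of_forall fun t => (Real.exp_pos _).le

theorem lintegral_Ioi_pow_mul_exp_neg (n : ℕ) :
    ∫⁻ s in Set.Ioi (0 : ℝ), ENNReal.ofReal (Real.exp (-s) * s ^ n)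
      = ENNReal.ofReal (n.factorial : ℝ) := by
  have h1 := Real.GammaIntegral_convergent (s := (n : ℝ) + 1) (by positivity)
  have h2 := Real.Gamma_eq_integral (s := (n : ℝ) + 1) (by positivity)
  simp only [add_sub_cancel_right, Real.rpow_natCast] at h1 h2
  rw [Real.Gamma_nat_eq_factorial] at h2
  rw [h2, ofReal_integral_eq_lintegral_ofReal h1]
  filter_upwards [ae_restrict_mem measurableSet_Ioi] with s hs
  have : (0 : ℝ) < s := hs
  positivity

theorem snoc_smul {n : ℕ} (s : ℝ) (x : Fin n → ℝ) :
    (Fin.snoc (s • x) s : Fin (n + 1) → ℝ) = s • (Fin.snoc x 1 : Fin (n + 1) → ℝ) := by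
  funext k
  refine Fin.lastCases ?_ (fun i => ?_) k <;> simp

/-- Volume of a simplex cut out of the hyperplane `z (last n) = 1` by the inequalities `0 ≤ M z`,
for a unimodular matrix `M` in whose rows the last coordinate is a positive combination. -/
theorem volume_unimodular_simplex_le {n : ℕ} (M : Matrix (Fin (n + 1)) (Fin (n + 1)) ℝ)
    (hM : |M.det| = 1) (c : Fin (n + 1) → ℝ) (hc : ∀ k, 0 < c k)
    (hcM : ∀ z, ∑ k, c k * (M.mulVec z) k = z (Fin.last n)) :
    volume {x : Fin n → ℝ | ∀ k, 0 ≤ M.mulVec (Fin.snoc x 1) k} ≤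
      ENNReal.ofReal (1 / (n.factorial * ∏ k, c k)) := by
  set A := {x : Fin n → ℝ | ∀ k, 0 ≤ M.mulVec (Fin.snoc x 1) k} with hA
  set g : (Fin (n + 1) → ℝ) → ENNReal := fun e => ∏ k,
    (Set.Ici (0 : ℝ)).indicator (fun t => ENNReal.ofReal (Real.exp (-(c k * t)))) (e k) with hg
  have hfm : ∀ k, Measurable ((Set.Ici (0 : ℝ)).indicator
      (fun t => ENNReal.ofReal (Real.exp (-(c k * t))))) := fun k =>
    Measurable.indicator (by fun_prop) measurableSet_Ici
  have hgm : Measurable g := by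
    refine Finset.measurable_prod _ fun k _ => (hfm k).comp (measurable_pi_apply k)
  have hgint : ∫⁻ e, g e = ENNReal.ofReal (1 / ∏ k, c k) := by
    rw [hg, lintegral_fin_prod_eq_prod _ _ hfm]
    simp_rw [lintegral_indicator_exp_neg_mul (hc _)]
    rw [← ENNReal.ofReal_prod_of_nonneg (fun k _ => by have := hc k; positivity)]
    simp
  have hdet : M.det ≠ 0 := by intro h; simp [h] at hM
  have hmap : Measure.map (Matrix.toLin' M) volume = volume := by
    rw [Real.map_matrix_volume_pi_eq_smul_volume_pi hdet, abs_inv, hM]; simp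
  have hMm : Measurable (Matrix.toLin' M) :=
    (LinearMap.continuous_of_finiteDimensional _).measurable
  have hcomp : ∫⁻ z, g (M.mulVec z) = ENNReal.ofReal (1 / ∏ k, c k) := by
    rw [← hgint]
    conv_rhs => rw [← hmap, lintegral_map hgm hMm]
    rfl
  -- At height `s` the cone `0 ≤ M z` has cross-section `s • A`, and by `hcM` the exponents there
  -- add up to `-s`. Integrating over `s` then produces the factor n!.
  have hgM : ∀ x : Fin n → ℝ, ∀ s : ℝ, 0 < s →
      g (M.mulVec (Fin.snoc x s)) =
        (s • A).indicator (fun _ => ENNReal.ofReal (Real.exp (-s))) x := by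
    intro x s hs
    have hmem : x ∈ s • A ↔ ∀ k, 0 ≤ M.mulVec (Fin.snoc x s) k := by
      rw [Set.mem_smul_set_iff_inv_smul_mem₀ hs.ne', hA, Set.mem_ofPred_eq]
      have : (Fin.snoc x s : Fin (n + 1) → ℝ) = s • Fin.snoc (s⁻¹ • x) 1 := by
        rw [← snoc_smul, smul_inv_smul₀ hs.ne']
      rw [this, Matrix.mulVec_smul]
      simp [hs]
    by_cases hx : x ∈ s • A
    · rw [Set.indicator_of_mem hx, hg]
      have h' := hmem.1 hx
      simp only
      rw [Finset.prod_congr rfl (fun k _ => Set.indicator_of_mem (Set.mem_Ici.2 (h' k)) _),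
        ← ENNReal.ofReal_prod_of_nonneg (fun k _ => (Real.exp_pos _).le), ← Real.exp_sum,
        Finset.sum_neg_distrib, hcM]
      simp
    · rw [Set.indicator_of_notMem hx, hg]
      obtain ⟨k, hk⟩ := not_forall.1 (hx ∘ hmem.2)
      refine Finset.prod_eq_zero (Finset.mem_univ k) (Set.indicator_of_notMem ?_ _)
      simpa using hk
  have hAm : MeasurableSet A := by
    have : A = ⋂ k, {x : Fin n → ℝ | 0 ≤ M.mulVec (Fin.snoc x 1) k} := by ext; simp [hA]
    rw [this]
    refine MeasurableSet.iInter fun k => measurableSet_le measurable_const ?_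
    have : Continuous fun x : Fin n → ℝ => M.mulVec (Fin.snoc x 1) k := by
      have h0 : Continuous fun x : Fin n → ℝ => (Fin.snoc x 1 : Fin (n + 1) → ℝ) :=
        continuous_pi fun i => by
          refine Fin.lastCases ?_ (fun i => ?_) i <;> simp <;> fun_prop
      have := (LinearMap.continuous_of_finiteDimensional (Matrix.toLin' M)).comp h0
      exact (continuous_apply k).comp this
    exact this.measurable
  have hslice : ∀ s : ℝ, 0 < s → ∫⁻ x : Fin n → ℝ, g (M.mulVec (Fin.snoc x s)) =
      ENNReal.ofReal (Real.exp (-s) * s ^ n) * volume A := by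
    intro s hs
    simp_rw [hgM _ s hs]
    rw [lintegral_indicator_const (hAm.const_smul₀ s), Measure.addHaar_smul,
      ENNReal.ofReal_mul (Real.exp_pos _).le, mul_assoc]
    simp [abs_of_pos hs]
  have e := (volume_preserving_piFinSuccAbove (fun _ : Fin (n + 1) => ℝ) (Fin.last n)).symm
  have hfub : ∫⁻ z, g (M.mulVec z) = ∫⁻ s : ℝ, ∫⁻ x : Fin n → ℝ, g (M.mulVec (Fin.snoc x s)) := by
    rw [← e.lintegral_comp (f := fun z => g (M.mulVec z)) (hgm.comp hMm), Measure.volume_eq_prod,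
      lintegral_prod]
    · refine lintegral_congr fun s => lintegral_congr fun x => ?_
      simp [MeasurableEquiv.piFinSuccAbove, Fin.snocEquiv]
    · exact ((hgm.comp hMm).comp (MeasurableEquiv.measurable _)).aemeasurable
  have hfac : ENNReal.ofReal (n.factorial : ℝ) * volume A ≤ ENNReal.ofReal (1 / ∏ k, c k) := by
    rw [← hcomp, hfub, ← lintegral_Ioi_pow_mul_exp_neg, ← lintegral_mul_const _ (by fun_prop)]
    -- Dropping the heights `s ≤ 0` is harmless, since only an upper bound on the volume is needed.
    refine le_trans (le_of_eq ?_) (setLIntegral_le_lintegral (Set.Ioi (0 : ℝ)) _)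
    exact setLIntegral_congr_fun measurableSet_Ioi fun s hs => (hslice s hs).symm
  have hf0 : (0 : ℝ) < n.factorial := by positivity
  rw [one_div, mul_inv, ENNReal.ofReal_mul (by positivity), ENNReal.ofReal_inv_of_pos hf0,
    ← ENNReal.div_eq_inv_mul, ← one_div (∏ k, c k)]
  rw [ENNReal.le_div_iff_mul_le (Or.inl (by simpa using Nat.factorial_ne_zero n)) (Or.inl (by simp)), mul_comm]
  exact hfac

/-! ### Slack coordinates for the piece lengths. -/

theorem det_toMatrix'_eq_one_of_unitriangular {n : ℕ} (f : (Fin n → ℝ) →ₗ[ℝ] (Fin n → ℝ))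
    (h : ∀ x i, (∀ j < i, x j = 0) → f x i = x i) : (LinearMap.toMatrix' f).det = 1 := by
  have key : ∀ i j, i ≤ j → LinearMap.toMatrix' f i j = if i = j then 1 else 0 := by
    intro i j hij
    rw [LinearMap.toMatrix'_apply, h]
    · simp [Pi.single_apply]
    · intro k hk
      simp [(hk.trans_le hij).ne]
  rw [Matrix.det_of_isLowerTriangular]
  · exact Finset.prod_eq_one fun i _ => by simp [key i i le_rfl]
  · intro i j hij
    have hij' : i < j := hij
    simp [key i j hij'.le, hij'.ne]

/-- The linear map subtracting from each coordinate the sum of the coordinates in a given set. -/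
def subtractSum {n : ℕ} (R : Fin n → Finset (Fin n)) : (Fin n → ℝ) →ₗ[ℝ] (Fin n → ℝ) where
  toFun h i := h i - ∑ j ∈ R i, h j
  map_add' x y := by
    funext i; simp only [Pi.add_apply, Finset.sum_add_distrib]; ring
  map_smul' a x := by
    funext i; simp [← Finset.mul_sum, mul_sub]

theorem det_subtractSum {n : ℕ} (R : Fin n → Finset (Fin n)) (hR : ∀ i, ∀ j ∈ R i, j < i) :
    (LinearMap.toMatrix' (subtractSum R)).det = 1 := by
  refine det_toMatrix'_eq_one_of_unitriangular _ fun x i hx => ?_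
  have : ∑ j ∈ R i, x j = 0 := Finset.sum_eq_zero fun j hj => hx j (hR i j hj)
  simp [subtractSum, this]

/-- After exchanging the sums, `h j` has coefficient `c j` minus the weights of all `k` with `j ∈ R
k`, which is 1 by `hc`. -/
theorem sum_mul_subtractSum {n : ℕ} (R : Fin n → Finset (Fin n)) (c : Fin n → ℝ)
    (hc : ∀ j, c j = 1 + ∑ k with j ∈ R k, c k) (h : Fin n → ℝ) :
    ∑ k, c k * subtractSum R h k = ∑ k, h k := by
  have h1 : ∑ k, c k * ∑ j ∈ R k, h j = ∑ j, (∑ k with j ∈ R k, c k) * h j := by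
    simp_rw [Finset.mul_sum, Finset.sum_mul]
    exact Finset.sum_comm' (by simp)
  simp only [subtractSum, LinearMap.coe_mk, AddHom.coe_mk, mul_sub, Finset.sum_sub_distrib]
  rw [h1, ← Finset.sum_sub_distrib]
  refine Finset.sum_congr rfl fun j _ => ?_
  rw [hc j]; ring

/-- The differences between consecutive entries of `0, y 0, …, y (n - 1), 1`. -/
def gaps {n : ℕ} (y : Fin n → ℝ) (i : Fin (n + 1)) : ℝ :=
  (Fin.snoc y 1 : Fin (n + 1) → ℝ) i - (Fin.cons 0 y : Fin (n + 1) → ℝ) i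

/-- The differences between consecutive entries of `0, z 0, …, z n`. -/
def differences (n : ℕ) : (Fin (n + 1) → ℝ) →ₗ[ℝ] (Fin (n + 1) → ℝ) where
  toFun z i := z i - (Fin.cons 0 (Fin.init z) : Fin (n + 1) → ℝ) i
  map_add' x y := by
    funext i
    refine Fin.cases ?_ (fun i => ?_) i
    · simp
    · simp [Fin.init]; ring
  map_smul' a x := by
    funext i
    refine Fin.cases ?_ (fun i => ?_) i
    · simp
    · simp [Fin.init]; ring

theorem differences_snoc_one {n : ℕ} (y : Fin n → ℝ) :
    differences n (Fin.snoc y 1) = gaps y := by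
  funext i
  simp [differences, gaps]

theorem sum_differences {n : ℕ} (z : Fin (n + 1) → ℝ) :
    ∑ i, differences n z i = z (Fin.last n) := by
  simp only [differences, LinearMap.coe_mk, AddHom.coe_mk, Finset.sum_sub_distrib]
  rw [Fin.sum_univ_succ (Fin.cons _ _), Fin.sum_univ_castSucc z]
  simp [Fin.init]

theorem det_differences (n : ℕ) : (LinearMap.toMatrix' (differences n)).det = 1 := by
  refine det_toMatrix'_eq_one_of_unitriangular _ fun x i hx => ?_
  revert hx
  refine Fin.cases ?_ (fun i => ?_) i
  · simp [differences]
  · intro hx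
    simp [differences, Fin.init, hx i.castSucc i.castSucc_lt_succ]

/-- With `y` homogenised to `Fin.snoc y 1`, the slacks arise by taking differences, permuting by `ρ`
and subtracting sums: determinants 1, ±1 and 1. Their `c`-weighted sum is the total length, which is
the last coordinate. -/
theorem volume_gaps_le {n : ℕ} (R : Fin (n + 1) → Finset (Fin (n + 1)))
    (hR : ∀ i, ∀ j ∈ R i, j < i) (c : Fin (n + 1) → ℝ) (hc0 : ∀ k, 0 < c k)
    (hc : ∀ j, c j = 1 + ∑ k with j ∈ R k, c k) (ρ : Equiv.Perm (Fin (n + 1))) :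
    volume {y : Fin n → ℝ | ∀ k, ∑ j ∈ R k, gaps y (ρ j) ≤ gaps y (ρ k)} ≤
      ENNReal.ofReal (1 / (n.factorial * ∏ k, c k)) := by
  set M := LinearMap.toMatrix' (subtractSum R) *
    (LinearMap.toMatrix' (differences n)).submatrix ρ id with hMdef
  have hmul : ∀ z, M.mulVec z = subtractSum R (differences n z ∘ ρ) := by
    intro z
    rw [hMdef, ← Matrix.mulVec_mulVec, LinearMap.toMatrix'_mulVec]
    congr 1
    have := congrArg (· ∘ ρ) (LinearMap.toMatrix'_mulVec (differences n) z)
    rw [← this]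
    rfl
  refine le_trans (le_of_eq ?_) (volume_unimodular_simplex_le M ?_ c hc0 ?_)
  · congr 1
    ext y
    simp [hmul, differences_snoc_one, subtractSum]
  · rw [hMdef, Matrix.det_mul, Matrix.det_permute, det_subtractSum R hR, det_differences]
    rcases Int.units_eq_one_or (Equiv.Perm.sign ρ) with h | h <;> simp [h]
  · intro z
    simp_rw [hmul]
    rw [sum_mul_subtractSum R c hc, ← sum_differences z]
    exact Equiv.sum_comp ρ _

/-! ### Sorting the breaks and the pieces. -/

/-- Union bound over the order of the breaks; permuting coordinates preserves volume. `B` may depend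
on `σ` because the refined bound needs the rank of the last break. -/
theorem volume_exists_comp_perm_le {n : ℕ} (B : Equiv.Perm (Fin n) → Set (Fin n → ℝ)) :
    volume {x : Fin n → ℝ | ∃ σ : Equiv.Perm (Fin n), x ∘ σ ∈ B σ} ≤ ∑ σ, volume (B σ) := by
  have : {x : Fin n → ℝ | ∃ σ : Equiv.Perm (Fin n), x ∘ σ ∈ B σ} =
      ⋃ σ : Equiv.Perm (Fin n), (fun x : Fin n → ℝ => x ∘ σ) ⁻¹' B σ := by
    ext; simp
  rw [this]
  refine (measure_iUnion_fintype_le _ _).trans (Finset.sum_le_sum fun σ _ => le_of_eq ?_)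
  have e := volume_measurePreserving_piCongrLeft (fun _ : Fin n => ℝ) σ.symm
  have := e.measure_preimage_equiv (B σ)
  rw [← this]
  congr 1
  ext x
  have hx : MeasurableEquiv.piCongrLeft (fun _ : Fin n => ℝ) σ.symm x = x ∘ σ := by
    funext i
    simp [MeasurableEquiv.piCongrLeft, Equiv.piCongrLeft_apply]
  simp [hx]

theorem monotone_sortedBreaks {n : ℕ} (x : Fin n → ℝ) : Monotone (sortedBreaks x) :=
  Tuple.monotone_sort x

theorem pieceLength_eq_gaps {n : ℕ} (x : Fin n → ℝ) : pieceLength x = gaps (sortedBreaks x) := rfl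

theorem sortedBreaks_eq_comp {n : ℕ} {x : Fin n → ℝ} {σ : Equiv.Perm (Fin n)}
    (h : Monotone (x ∘ σ)) : sortedBreaks x = x ∘ σ :=
  (Tuple.comp_sort_eq_comp_iff_monotone.2 h).symm

theorem gaps_nonneg {n : ℕ} {y : Fin n → ℝ} (hy : Monotone y)
    (hy01 : ∀ i, y i ∈ Set.Icc (0 : ℝ) 1) (i : Fin (n + 1)) : 0 ≤ gaps y i := by
  rw [gaps, sub_nonneg]
  cases n with
  | zero => fin_cases i; simp [Fin.snoc]
  | succ n =>
    refine Fin.cases ?_ (fun i => ?_) i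
    · have : (0 : Fin (n + 1 + 1)) = Fin.castSucc 0 := rfl
      rw [Fin.cons_zero, this, Fin.snoc_castSucc]
      exact (hy01 0).1
    · rw [Fin.cons_succ]
      refine Fin.lastCases ?_ (fun i => ?_) i
      · rw [Fin.succ_last, Fin.snoc_last]
        exact (hy01 _).2
      · rw [Fin.succ_castSucc, Fin.snoc_castSucc]
        exact hy i.castSucc_lt_succ.le

/-! ### Triangle-free lengths and Fibonacci weights. -/

theorem add_le_of_not_isTriangle {a b c : ℝ} (hac : a ≤ c) (hbc : b ≤ c)
    (h : ¬ IsTriangle a b c) : a + b ≤ c := by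
  by_contra! hlt
  exact h ⟨by linarith, by linarith, hlt⟩

/-- The predecessors `k - 1` and `k - 2` of `k`, as far as they exist. -/
def twoBefore (n : ℕ) (k : Fin n) : Finset (Fin n) :=
  Finset.univ.filter fun j => j < k ∧ (k : ℕ) ≤ j + 2

/-- The first two indices have fewer than two predecessors: there the inequality is nonnegativity
and monotonicity respectively. -/
theorem sum_twoBefore_le {n : ℕ} {h : Fin n → ℝ} (h0 : ∀ i, 0 ≤ h i) (hmono : Monotone h)
    (hadd : ∀ i j k, i < j → j < k → h i + h j ≤ h k) (k : Fin n) :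
    ∑ j ∈ twoBefore n k, h j ≤ h k := by
  obtain ⟨k, hk⟩ := k
  match k, hk with
  | 0, hk =>
    have : twoBefore n ⟨0, hk⟩ = ∅ := by
      ext ⟨j, hj⟩
      simp [twoBefore]
    simp [this, h0]
  | 1, hk =>
    have : twoBefore n ⟨1, hk⟩ = {⟨0, by omega⟩} := by
      ext ⟨j, hj⟩
      simp only [twoBefore, Finset.mem_filter, Finset.mem_univ, true_and, Fin.mk_lt_mk,
        Finset.mem_singleton, Fin.mk.injEq]
      omega
    rw [this, Finset.sum_singleton]
    exact hmono (by simp)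
  | k + 2, hk =>
    have : twoBefore n ⟨k + 2, hk⟩ = {⟨k, by omega⟩, ⟨k + 1, by omega⟩} := by
      ext ⟨j, hj⟩
      simp only [twoBefore, Finset.mem_filter, Finset.mem_univ, true_and, Fin.mk_lt_mk,
        Finset.mem_singleton, Fin.mk.injEq, Finset.mem_insert]
      omega
    rw [this, Finset.sum_pair (by simp)]
    exact hadd _ _ _ (by simp) (by simp)

/-- `sideWeight n k` is the coefficient of the `k`-th slack in the total length of `n + 1` sticks,
sorted by length, no three of which form a triangle. -/
def sideWeight (n : ℕ) (k : Fin (n + 1)) : ℝ := (Nat.fib (n - k + 3) : ℝ) - 1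

theorem one_lt_fib_add_three (m : ℕ) : (1 : ℝ) < Nat.fib (m + 3) := by
  have h : Nat.fib 3 ≤ Nat.fib (m + 3) := Nat.fib_mono (by omega)
  have h' : 2 ≤ Nat.fib (m + 3) := h
  have : (2 : ℝ) ≤ Nat.fib (m + 3) := by exact_mod_cast h'
  linarith

theorem sideWeight_pos (n : ℕ) (k : Fin (n + 1)) : 0 < sideWeight n k :=
  sub_pos.2 (one_lt_fib_add_three _)

theorem prod_sideWeight (n : ℕ) :
    ∏ k, sideWeight n k = ∏ j ∈ Finset.range (n + 1), ((Nat.fib (j + 3) : ℝ) - 1) := by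
  rw [← Fin.prod_univ_eq_prod_range (fun j => (Nat.fib (j + 3) : ℝ) - 1),
    ← Equiv.prod_comp Fin.revPerm]
  refine Finset.prod_congr rfl fun k _ => ?_
  simp only [sideWeight, Fin.revPerm_apply, Fin.val_rev]
  have : n - (n + 1 - (k + 1)) = (k : ℕ) := by omega
  rw [this]

/-- Away from the end this is c_j = 1 + c_{j+1} + c_{j+2}, the Fibonacci recursion shifted by one.
The last two indices give the initial values 1 and 2. -/
theorem sideWeight_eq (n : ℕ) (j : Fin (n + 1)) :
    sideWeight n j = 1 + ∑ k with j ∈ twoBefore (n + 1) k, sideWeight n k := by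
  obtain ⟨j, hj⟩ := j
  obtain ⟨m, rfl⟩ : ∃ m, n = j + m := ⟨n - j, by omega⟩
  match m with
  | 0 =>
    have : (Finset.univ.filter fun k : Fin (j + 0 + 1) => ⟨j, hj⟩ ∈ twoBefore (j + 0 + 1) k) = ∅ := by
      ext ⟨k, hk⟩
      simp only [twoBefore, Finset.mem_filter, Finset.mem_univ, true_and, Fin.mk_lt_mk,
        Finset.notMem_empty, iff_false]
      omega
    rw [this]
    norm_num [sideWeight, Nat.fib_add_two]
  | 1 =>
    have : (Finset.univ.filter fun k : Fin (j + 1 + 1) => ⟨j, hj⟩ ∈ twoBefore (j + 1 + 1) k) =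
        {⟨j + 1, by omega⟩} := by
      ext ⟨k, hk⟩
      simp only [twoBefore, Finset.mem_filter, Finset.mem_univ, true_and, Fin.mk_lt_mk,
        Finset.mem_singleton, Fin.mk.injEq]
      omega
    rw [this]
    norm_num [sideWeight, Nat.fib_add_two]
  | m + 2 =>
    have : (Finset.univ.filter fun k : Fin (j + (m + 2) + 1) =>
        ⟨j, hj⟩ ∈ twoBefore (j + (m + 2) + 1) k) =
        {⟨j + 1, by omega⟩, ⟨j + 2, by omega⟩} := by
      ext ⟨k, hk⟩
      simp only [twoBefore, Finset.mem_filter, Finset.mem_univ, true_and, Fin.mk_lt_mk,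
        Finset.mem_singleton, Fin.mk.injEq, Finset.mem_insert]
      omega
    rw [this, Finset.sum_pair (by simp)]
    have e0 : j + (m + 2) - j + 3 = (m + 3) + 2 := by omega
    have e1 : j + (m + 2) - (j + 1) + 3 = m + 3 + 1 := by omega
    have e2 : j + (m + 2) - (j + 2) + 3 = m + 3 := by omega
    simp only [sideWeight, e0, e1, e2]
    rw [Nat.fib_add_two]
    push_cast
    ring

theorem gaps_sort_spec {n : ℕ} {x : Fin n → ℝ} (hx : ∀ i, x i ∈ Set.Icc (0 : ℝ) 1)
    (h : ¬ SomeThreeFormTriangle x) :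
    (∀ i, 0 ≤ gaps (sortedBreaks x) i) ∧
      ∀ i j k, i ≠ j → i ≠ k → j ≠ k →
        gaps (sortedBreaks x) i ≤ gaps (sortedBreaks x) k →
        gaps (sortedBreaks x) j ≤ gaps (sortedBreaks x) k →
        gaps (sortedBreaks x) i + gaps (sortedBreaks x) j ≤ gaps (sortedBreaks x) k := by
  have h0 := gaps_nonneg (monotone_sortedBreaks x) (fun i => hx _)
  refine ⟨h0, fun i j k hij hik hjk h1 h2 => ?_⟩
  refine add_le_of_not_isTriangle h1 h2 fun ht => h ⟨i, j, k, hij, hik, hjk, ht⟩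

theorem sum_twoBefore_gaps_le {n : ℕ} {x : Fin n → ℝ} (hx : ∀ i, x i ∈ Set.Icc (0 : ℝ) 1)
    (h : ¬ SomeThreeFormTriangle x) (k : Fin (n + 1)) :
    ∑ j ∈ twoBefore (n + 1) k, gaps (sortedBreaks x) (Tuple.sort (gaps (sortedBreaks x)) j) ≤
      gaps (sortedBreaks x) (Tuple.sort (gaps (sortedBreaks x)) k) := by
  obtain ⟨h0, h1⟩ := gaps_sort_spec hx h
  have hmono := Tuple.monotone_sort (gaps (sortedBreaks x))
  refine sum_twoBefore_le (fun i => h0 _) hmono (fun i j k hij hjk => ?_) k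
  refine h1 _ _ _ ?_ ?_ ?_ (hmono (hij.trans hjk).le) (hmono hjk.le)
  · simpa using hij.ne
  · simpa using (hij.trans hjk).ne
  · simpa using hjk.ne

/-- The probability that no three of the `n + 1` pieces form a triangle. -/
noncomputable def noTriangleProb (n : ℕ) : ℝ :=
  (n + 1).factorial / ∏ j ∈ Finset.range (n + 1), ((Nat.fib (j + 3) : ℝ) - 1)

/-- The n! orders of the breaks cancel the 1/n! of each simplex, leaving the (n+1)! orders of the
pieces. -/
theorem volume_no_triangle_le (n : ℕ) :
    volume {x : Fin n → ℝ | (∀ i, x i ∈ Set.Icc (0 : ℝ) 1) ∧ ¬ SomeThreeFormTriangle x} ≤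
      ENNReal.ofReal (noTriangleProb n) := by
  set B : Set (Fin n → ℝ) := ⋃ ρ : Equiv.Perm (Fin (n + 1)),
    {y | ∀ k, ∑ j ∈ twoBefore (n + 1) k, gaps y (ρ j) ≤ gaps y (ρ k)} with hB
  have hsub : {x : Fin n → ℝ | (∀ i, x i ∈ Set.Icc (0 : ℝ) 1) ∧ ¬ SomeThreeFormTriangle x} ⊆
      {x | ∃ σ : Equiv.Perm (Fin n), x ∘ σ ∈ B} := by
    rintro x ⟨hx, h⟩
    exact ⟨Tuple.sort x, Set.mem_iUnion.2 ⟨_, sum_twoBefore_gaps_le hx h⟩⟩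
  set r := (1 / (n.factorial * ∏ k, sideWeight n k)) with hr
  have hr0 : 0 ≤ r := by
    have := Finset.prod_nonneg fun k (_ : k ∈ Finset.univ) => (sideWeight_pos n k).le
    positivity
  have hBvol : volume B ≤ ENNReal.ofReal ((n + 1).factorial * r) := by
    refine (measure_iUnion_fintype_le _ _).trans ((Finset.sum_le_sum fun ρ _ =>
      volume_gaps_le _ ?_ _ (sideWeight_pos n) (sideWeight_eq n) ρ).trans ?_)
    · intro i j hj
      simp only [twoBefore, Finset.mem_filter] at hj
      exact hj.2.1
    · rw [Finset.sum_const, Finset.card_univ, Fintype.card_perm, Fintype.card_fin, nsmul_eq_mul,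
        ENNReal.ofReal_mul (by positivity), ENNReal.ofReal_natCast]
  refine (measure_mono hsub).trans ((volume_exists_comp_perm_le _).trans
    ((Finset.sum_le_sum fun σ _ => hBvol).trans (le_of_eq ?_)))
  rw [Finset.sum_const, Finset.card_univ, Fintype.card_perm, Fintype.card_fin, nsmul_eq_mul,
    ← ENNReal.ofReal_natCast, ← ENNReal.ofReal_mul (by positivity), noTriangleProb,
    ← prod_sideWeight, hr]
  congr 1
  have : (n.factorial : ℝ) ≠ 0 := by positivity
  field_simp

/-! ### The refined bound for three breaks. -/

theorem sum_gaps {n : ℕ} (y : Fin n → ℝ) : ∑ i, gaps y i = 1 := by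
  rw [← differences_snoc_one, sum_differences, Fin.snoc_last]

theorem exists_perm_castSucc_eq (σ : Equiv.Perm (Fin 3)) :
    ∃ τ : Equiv.Perm (Fin 2), ∀ k, (τ k).castSucc = σ ((σ⁻¹ 2).succAbove k) := by
  revert σ
  decide

/-- `(Tuple.sort x)⁻¹ 2` is the rank of the last break; undoing that break deletes this entry from
the sorted list. -/
theorem sortedBreaks_castSucc (x : Fin 3 → ℝ) :
    sortedBreaks (fun i : Fin 2 => x i.castSucc) =
      sortedBreaks x ∘ ((Tuple.sort x)⁻¹ 2).succAbove := by
  obtain ⟨τ, hτ⟩ := exists_perm_castSucc_eq (Tuple.sort x)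
  have h : (fun i : Fin 2 => x i.castSucc) ∘ τ =
      sortedBreaks x ∘ ((Tuple.sort x)⁻¹ 2).succAbove := by
    funext k
    simp [hτ, sortedBreaks]
  rw [← h]
  refine sortedBreaks_eq_comp ?_
  rw [h]
  exact (monotone_sortedBreaks x).comp (Fin.strictMono_succAbove _).monotone

/-- If the longest of four pieces is not involved in undoing a break, and there is no triangle
before and after that break, then this piece has length at least `1 / 2`. -/
theorem half_le_gap (y : Fin 3 → ℝ) (i : Fin 3) (m : Fin 4)
    (h0 : ∀ j, 0 ≤ gaps y j) (hmax : ∀ j, gaps y j ≤ gaps y m)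
    (hadd : ∀ j k, j ≠ k → j ≠ m → k ≠ m → gaps y j + gaps y k ≤ gaps y m)
    (hm1 : m ≠ i.castSucc) (hm2 : m ≠ i.succ)
    (h : ¬ IsTriangle (gaps (y ∘ i.succAbove) 0) (gaps (y ∘ i.succAbove) 1)
      (gaps (y ∘ i.succAbove) 2)) : 1 / 2 ≤ gaps y m := by
  have g0 : gaps y 0 = y 0 := by simp [gaps, Fin.snoc]
  have g1 : gaps y 1 = y 1 - y 0 := by simp [gaps, Fin.snoc, Fin.cons]; rfl
  have g2 : gaps y 2 = y 2 - y 1 := by simp [gaps, Fin.snoc, Fin.cons]; rfl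
  have g3 : gaps y 3 = 1 - y 2 := by simp [gaps, Fin.snoc, Fin.cons]; rfl
  have f0 : ∀ z : Fin 2 → ℝ, gaps z 0 = z 0 := fun z => by simp [gaps, Fin.snoc]
  have f1 : ∀ z : Fin 2 → ℝ, gaps z 1 = z 1 - z 0 := fun z => by
    simp [gaps, Fin.snoc, Fin.cons]; rfl
  have f2 : ∀ z : Fin 2 → ℝ, gaps z 2 = 1 - z 1 := fun z => by
    simp [gaps, Fin.snoc, Fin.cons]; rfl
  rw [f0, f1, f2] at h
  obtain ⟨a0, a1, a2, a3⟩ := (⟨h0 0, h0 1, h0 2, h0 3⟩ : _ ∧ _ ∧ _ ∧ _)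
  obtain ⟨b0, b1, b2, b3⟩ := (⟨hmax 0, hmax 1, hmax 2, hmax 3⟩ : _ ∧ _ ∧ _ ∧ _)
  obtain ⟨c01, c02, c03, c12, c13, c23⟩ :=
    (⟨hadd 0 1, hadd 0 2, hadd 0 3, hadd 1 2, hadd 1 3, hadd 2 3⟩ : _ ∧ _ ∧ _ ∧ _ ∧ _ ∧ _)
  clear h0 hmax hadd f0 f1 f2
  -- Let m < 1/2 be the longest piece, p and q the pieces being merged, r the fourth. Then p + q + r
  -- > 1/2 > m, while p + q ≤ m forces r > 0 and r ≤ m forces p + q > 0. Hence m, p + q, r form a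
  -- triangle.
  by_contra! hlt
  apply h
  clear h
  have i00 : Fin.succAbove (0 : Fin 3) (0 : Fin 2) = 1 := by decide
  have i01 : Fin.succAbove (0 : Fin 3) (1 : Fin 2) = 2 := by decide
  have i10 : Fin.succAbove (1 : Fin 3) (0 : Fin 2) = 0 := by decide
  have i11 : Fin.succAbove (1 : Fin 3) (1 : Fin 2) = 2 := by decide
  have i20 : Fin.succAbove (2 : Fin 3) (0 : Fin 2) = 0 := by decide
  have i21 : Fin.succAbove (2 : Fin 3) (1 : Fin 2) = 1 := by decide
  have hi : i = 0 ∨ i = 1 ∨ i = 2 := by clear * -; revert i; decide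
  have hm : m = 0 ∨ m = 1 ∨ m = 2 ∨ m = 3 := by clear * -; revert m; decide
  rcases hi with rfl | rfl | rfl <;> rcases hm with rfl | rfl | rfl | rfl <;>
    simp only [ne_eq, Fin.reduceEq, not_true_eq_false, not_false_eq_true, forall_true_left,
      false_imp_iff, g0, g1, g2, g3, Fin.reduceSucc, Fin.reduceCastSucc, Fin.isValue, Fin.castSucc_zero,
      Fin.castSucc_one, Fin.succ_zero_eq_one, Fin.succ_one_eq_two,
      Function.comp_apply, i00, i01, i10, i11, i20, i21] at * <;>
    exact ⟨by linarith, by linarith, by linarith⟩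

theorem card_perm_apply_three (i : Fin 3) :
    (Finset.univ.filter fun ρ : Equiv.Perm (Fin 4) => ρ 3 = i.castSucc ∨ ρ 3 = i.succ).card = 12 ∧
    (Finset.univ.filter fun ρ : Equiv.Perm (Fin 4) =>
      ¬ (ρ 3 = i.castSucc ∨ ρ 3 = i.succ)).card = 12 := by
  revert i
  decide

/-- For each order of the breaks, 12 of the 24 orders of the pieces make the longest piece adjacent
to the last break and keep the simplex volume 1/336. For the other 12 the longest piece is at least
1/2, hence at least the sum of the other three, and the volume drops to 1/384. The total is 6
(12/336 + 12/384) = 45/112. -/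
theorem volume_no_triangle_two_three_le :
    volume {x : Fin 3 → ℝ | (∀ i, x i ∈ Set.Icc (0 : ℝ) 1) ∧ ¬ SomeThreeFormTriangle x ∧
      ¬ SomeThreeFormTriangle (fun i : Fin 2 => x i.castSucc)} ≤ ENNReal.ofReal (45 / 112) := by
  set R1 : Equiv.Perm (Fin 4) → Set (Fin 3 → ℝ) := fun ρ =>
    {y | ∀ k, ∑ j ∈ twoBefore 4 k, gaps y (ρ j) ≤ gaps y (ρ k)} with hR1
  set R2 : Equiv.Perm (Fin 4) → Set (Fin 3 → ℝ) := fun ρ =>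
    {y | ∀ k, ∑ j ∈ Finset.Iio k, gaps y (ρ j) ≤ gaps y (ρ k)} with hR2
  have v1 : ∀ ρ, volume (R1 ρ) ≤ ENNReal.ofReal (1 / 336) := by
    intro ρ
    refine (volume_gaps_le _ ?_ _ (sideWeight_pos 3) (sideWeight_eq 3) ρ).trans (le_of_eq ?_)
    · intro i j hj
      simp only [twoBefore, Finset.mem_filter] at hj
      exact hj.2.1
    · rw [prod_sideWeight]
      norm_num [Finset.prod_range_succ, Nat.fib_add_two, Nat.factorial]
  have v2 : ∀ ρ, volume (R2 ρ) ≤ ENNReal.ofReal (1 / 384) := by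
    intro ρ
    -- When each length dominates the sum of all shorter ones, the weights solve c_j = 1 + ∑_{k>j}
    -- c_k: powers of two.
    obtain ⟨c, c0, c1, c2, c3⟩ : ∃ c : Fin 4 → ℝ, c 0 = 8 ∧ c 1 = 4 ∧ c 2 = 2 ∧ c 3 = 1 :=
      ⟨![8, 4, 2, 1], rfl, rfl, rfl, rfl⟩
    have cases4 : ∀ k : Fin 4, k = 0 ∨ k = 1 ∨ k = 2 ∨ k = 3 := by decide
    have hc0 : ∀ k, 0 < c k := by
      intro k
      rcases cases4 k with rfl | rfl | rfl | rfl <;> simp [c0, c1, c2, c3]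
    have hcs : ∀ j : Fin 4, c j = 1 + ∑ k with j ∈ Finset.Iio k, c k := by
      intro j
      simp only [Finset.sum_filter, Finset.mem_Iio, Fin.sum_univ_four, c0, c1, c2, c3]
      rcases cases4 j with rfl | rfl | rfl | rfl <;>
        norm_num [c0, c1, c2, c3, Fin.lt_def]
    have hprod : ∏ k : Fin 4, c k = 64 := by
      rw [Fin.prod_univ_four, c0, c1, c2, c3]
      norm_num
    refine (volume_gaps_le (fun k => Finset.Iio k) (by simp) c hc0 hcs ρ).trans (le_of_eq ?_)
    rw [hprod]
    norm_num [Nat.factorial]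
  set B : Equiv.Perm (Fin 3) → Set (Fin 3 → ℝ) := fun σ =>
    ⋃ ρ : Equiv.Perm (Fin 4),
      if ρ 3 = (σ⁻¹ 2).castSucc ∨ ρ 3 = (σ⁻¹ 2).succ then R1 ρ else R2 ρ with hB
  have vB : ∀ σ, volume (B σ) ≤ ENNReal.ofReal (15 / 224) := by
    intro σ
    have hle : ∀ ρ : Equiv.Perm (Fin 4),
        volume (if ρ 3 = (σ⁻¹ 2).castSucc ∨ ρ 3 = (σ⁻¹ 2).succ then R1 ρ else R2 ρ) ≤
        if ρ 3 = (σ⁻¹ 2).castSucc ∨ ρ 3 = (σ⁻¹ 2).succ then ENNReal.ofReal (1 / 336)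
          else ENNReal.ofReal (1 / 384) := by
      intro ρ
      split_ifs
      exacts [v1 ρ, v2 ρ]
    refine (measure_iUnion_fintype_le _ _).trans ((Finset.sum_le_sum fun ρ _ => hle ρ).trans
      (le_of_eq ?_))
    obtain ⟨h1, h2⟩ := card_perm_apply_three (σ⁻¹ 2)
    rw [Finset.sum_ite, Finset.sum_const, Finset.sum_const, h1, h2, ← ENNReal.ofReal_nsmul,
      ← ENNReal.ofReal_nsmul, ← ENNReal.ofReal_add (by positivity) (by positivity)]
    norm_num
  have hsub : {x : Fin 3 → ℝ | (∀ i, x i ∈ Set.Icc (0 : ℝ) 1) ∧ ¬ SomeThreeFormTriangle x ∧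
      ¬ SomeThreeFormTriangle (fun i : Fin 2 => x i.castSucc)} ⊆
      {x | ∃ σ : Equiv.Perm (Fin 3), x ∘ σ ∈ B σ} := by
    rintro x ⟨hx, h, h'⟩
    set g := gaps (sortedBreaks x) with hg
    have hfib := sum_twoBefore_gaps_le hx h
    refine ⟨Tuple.sort x, Set.mem_iUnion.2 ⟨Tuple.sort g, ?_⟩⟩
    split_ifs with hcase
    · exact hfib
    · obtain ⟨hc1, hc2⟩ := not_or.1 hcase
      obtain ⟨h0, h1⟩ := gaps_sort_spec hx h
      have hmono : Monotone (g ∘ Tuple.sort g) := Tuple.monotone_sort g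
      have hmax : ∀ j, g j ≤ g (Tuple.sort g 3) := by
        intro j
        have := hmono (Fin.le_last ((Tuple.sort g).symm j))
        simpa using this
      have hhalf : 1 / 2 ≤ g (Tuple.sort g 3) := by
        refine half_le_gap (sortedBreaks x) ((Tuple.sort x)⁻¹ 2) (Tuple.sort g 3) h0 hmax
          (fun j k hjk hj hk => h1 _ _ _ hjk hj hk (hmax _) (hmax _)) hc1 hc2 fun ht => h' ?_
        refine ⟨0, 1, 2, by decide, by decide, by decide, ?_⟩
        rw [pieceLength_eq_gaps, sortedBreaks_castSucc]
        exact ht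
      have hsum : ∑ j, g (Tuple.sort g j) = 1 :=
        (Equiv.sum_comp (Tuple.sort g) g).trans (sum_gaps _)
      rw [Fin.sum_univ_four] at hsum
      intro k
      have hk := hfib k
      change ∑ j ∈ Finset.Iio k, g (Tuple.sort g j) ≤ g (Tuple.sort g k)
      change ∑ j ∈ twoBefore 4 k, g (Tuple.sort g j) ≤ g (Tuple.sort g k) at hk
      have hk3 : k ≠ 3 ∨ k = 3 := ne_or_eq k 3
      -- Only the longest piece has more than two predecessors, so only there does the bound 1/2 add
      -- anything.
      rcases hk3 with hk3 | rfl
      · have : Finset.Iio k = twoBefore 4 k := by clear hk; revert k; decide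
        rwa [this]
      · have : Finset.Iio (3 : Fin 4) = {0, 1, 2} := by decide
        rw [this, Finset.sum_insert (by decide), Finset.sum_pair (by decide)]
        linarith
  refine (measure_mono hsub).trans ((volume_exists_comp_perm_le _).trans
    ((Finset.sum_le_sum fun σ _ => vB σ).trans (le_of_eq ?_)))
  rw [Finset.sum_const, Finset.card_univ, Fintype.card_perm, Fintype.card_fin,
    ← ENNReal.ofReal_nsmul]
  norm_num [Nat.factorial]

/-! ### Measurability. -/

theorem measurable_gaps {n : ℕ} (i : Fin (n + 1)) : Measurable fun y : Fin n → ℝ => gaps y i := by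
  refine Measurable.sub ?_ ?_
  · refine Fin.lastCases ?_ (fun i => ?_) i
    · simp
    · simpa using measurable_pi_apply i
  · refine Fin.cases ?_ (fun i => ?_) i
    · simp
    · simpa using measurable_pi_apply i

/-- The sets where `x ∘ σ` is monotone are measurable and cover the space, and on each of them
sorting is the coordinate permutation `σ`. -/
theorem measurable_sortedBreaks {n : ℕ} : Measurable (sortedBreaks : (Fin n → ℝ) → Fin n → ℝ) := by
  have hmono : ∀ σ : Equiv.Perm (Fin n), MeasurableSet {x : Fin n → ℝ | Monotone (x ∘ σ)} := by
    intro σ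
    have : {x : Fin n → ℝ | Monotone (x ∘ σ)} =
        ⋂ (i : Fin n) (j : Fin n) (_ : i ≤ j), {x | x (σ i) ≤ x (σ j)} := by
      ext x
      simp [Monotone]
    rw [this]
    exact MeasurableSet.iInter fun i => MeasurableSet.iInter fun j => MeasurableSet.iInter fun _ =>
      measurableSet_le (measurable_pi_apply _) (measurable_pi_apply _)
  intro s hs
  have : sortedBreaks ⁻¹' s = ⋃ σ : Equiv.Perm (Fin n),
      {x : Fin n → ℝ | Monotone (x ∘ σ)} ∩ (fun x : Fin n → ℝ => x ∘ σ) ⁻¹' s := by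
    ext x
    simp only [Set.mem_preimage, Set.mem_iUnion, Set.mem_inter_iff]
    constructor
    · exact fun h => ⟨Tuple.sort x, Tuple.monotone_sort x, h⟩
    · rintro ⟨σ, h, hx⟩
      rw [sortedBreaks_eq_comp h]
      exact hx
  rw [this]
  refine MeasurableSet.iUnion fun σ => (hmono σ).inter ?_
  exact measurable_pi_lambda _ (fun i => measurable_pi_apply (σ i)) hs

theorem measurableSet_someThreeFormTriangle (n : ℕ) :
    MeasurableSet {x : Fin n → ℝ | SomeThreeFormTriangle x} := by
  have hm : ∀ i, Measurable fun x : Fin n → ℝ => pieceLength x i := fun i =>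
    (measurable_gaps i).comp measurable_sortedBreaks
  have : {x : Fin n → ℝ | SomeThreeFormTriangle x} =
      ⋃ (i : Fin (n + 1)) (j : Fin (n + 1)) (k : Fin (n + 1)) (_ : i ≠ j ∧ i ≠ k ∧ j ≠ k),
        ({x | pieceLength x i < pieceLength x j + pieceLength x k} ∩
          {x | pieceLength x j < pieceLength x k + pieceLength x i}) ∩
          {x | pieceLength x k < pieceLength x i + pieceLength x j} := by
    ext x
    simp only [SomeThreeFormTriangle, IsTriangle, Set.mem_iUnion, Set.mem_inter_iff,
      Set.mem_ofPred_eq, exists_prop, and_assoc]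
  rw [this]
  refine MeasurableSet.iUnion fun i => MeasurableSet.iUnion fun j => MeasurableSet.iUnion fun k =>
    MeasurableSet.iUnion fun _ => ?_
  exact ((measurableSet_lt (hm i) ((hm j).add (hm k))).inter
    (measurableSet_lt (hm j) ((hm k).add (hm i)))).inter
    (measurableSet_lt (hm k) ((hm i).add (hm j)))

/-! ### Tail sums and transfer to volumes in the cube. -/

theorem coe_le_breaksUntilTriangle_iff (u : ℕ → ℝ) (m : ℕ) :
    (m : ℕ∞) ≤ breaksUntilTriangle u ↔
      ∀ k < m, ¬ SomeThreeFormTriangle (fun i : Fin k => u i) := by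
  rw [breaksUntilTriangle, le_iInf₂_iff]
  refine forall_congr' fun k => ?_
  rw [Nat.cast_le, ← not_lt, imp_not_comm]

theorem coe_lt_breaksUntilTriangle_iff (u : ℕ → ℝ) (m : ℕ) :
    (m : ℕ∞) < breaksUntilTriangle u ↔
      ∀ k ≤ m, ¬ SomeThreeFormTriangle (fun i : Fin k => u i) := by
  rw [← ENat.add_one_le_iff (ENat.natCast_ne_top m), ← Nat.cast_one (R := ℕ∞), ← Nat.cast_add,
    coe_le_breaksUntilTriangle_iff]
  simp only [Nat.lt_succ_iff]

/-- Pointwise form of the tail-sum formula for the expectation, valid also at `⊤`. -/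
theorem tsum_coe_lt_indicator (x : ℕ∞) :
    ∑' m : ℕ, (if (m : ℕ∞) < x then (1 : ENNReal) else 0) = x := by
  cases x with
  | top => simp
  | coe n =>
    rw [tsum_eq_sum (s := Finset.range n) (by intro b hb; simpa using hb),
      Finset.sum_congr rfl (g := fun _ => (1 : ENNReal))
        (by intro b hb; simpa using Finset.mem_range.1 hb)]
    simp

section

variable {Ω : Type*} [MeasurableSpace Ω] {μ : Measure Ω} {U : ℕ → Ω → ℝ}

theorem measurableSet_coe_lt_breaksUntilTriangle (hU : ∀ n, Measurable (U n)) (m : ℕ) :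
    MeasurableSet {ω | (m : ℕ∞) < breaksUntilTriangle (fun n => U n ω)} := by
  have : {ω | (m : ℕ∞) < breaksUntilTriangle (fun n => U n ω)} =
      ⋂ (k : ℕ) (_ : k ≤ m), ((fun ω (i : Fin k) => U i ω) ⁻¹' {x | SomeThreeFormTriangle x})ᶜ := by
    ext ω
    simp [coe_lt_breaksUntilTriangle_iff]
  rw [this]
  exact MeasurableSet.iInter fun k => MeasurableSet.iInter fun _ =>
    (measurable_pi_lambda (fun ω (i : Fin k) => U i ω) (fun i => hU i)
      (measurableSet_someThreeFormTriangle k)).compl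

theorem measurable_breaksUntilTriangle (hU : ∀ n, Measurable (U n)) :
    Measurable fun ω => breaksUntilTriangle (fun n => U n ω) := by
  have hlt := measurableSet_coe_lt_breaksUntilTriangle hU
  refine measurable_to_countable' fun x => ?_
  cases x with
  | top =>
    have : (fun ω => breaksUntilTriangle (fun n => U n ω)) ⁻¹' {⊤} =
        ⋂ m : ℕ, {ω | (m : ℕ∞) < breaksUntilTriangle (fun n => U n ω)} := by
      ext ω
      simp [ENat.eq_top_iff_forall_gt]
    rw [this]
    exact MeasurableSet.iInter hlt
  | coe n =>
    have : (fun ω => breaksUntilTriangle (fun n => U n ω)) ⁻¹' {(n : ℕ∞)} =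
        (⋂ (m : ℕ) (_ : m < n), {ω | (m : ℕ∞) < breaksUntilTriangle (fun n => U n ω)}) \
          {ω | (n : ℕ∞) < breaksUntilTriangle (fun n => U n ω)} := by
      ext ω
      generalize hx : breaksUntilTriangle (fun n => U n ω) = x
      simp only [Set.mem_preimage, hx, Set.mem_singleton_iff, Set.mem_sdiff, Set.mem_iInter,
        Set.mem_ofPred_eq, not_lt]
      constructor
      · rintro rfl
        simp
      · rintro ⟨h1, h2⟩
        refine le_antisymm h2 ?_
        lift x to ℕ using ne_top_of_le_ne_top (ENat.natCast_ne_top n) h2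
        by_contra! hlt
        exact lt_irrefl _ (h1 x (by simpa using hlt))
    rw [this]
    exact (MeasurableSet.iInter fun m => MeasurableSet.iInter fun _ => hlt m).diff (hlt n)

theorem lintegral_breaksUntilTriangle (hU : ∀ n, Measurable (U n)) :
    ∫⁻ ω, (breaksUntilTriangle (fun n => U n ω) : ENNReal) ∂μ =
      ∑' m : ℕ, μ {ω | (m : ℕ∞) < breaksUntilTriangle (fun n => U n ω)} := by
  have hlt := measurableSet_coe_lt_breaksUntilTriangle hU
  simp_rw [← tsum_coe_lt_indicator (breaksUntilTriangle _)]
  rw [lintegral_tsum fun m =>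
    (Measurable.ite (hlt m) measurable_const measurable_const).aemeasurable]
  refine tsum_congr fun m => ?_
  rw [← lintegral_indicator_one (hlt m)]
  exact lintegral_congr fun ω => by simp [Set.indicator_apply]

theorem map_uniform_eq_restrict_cube [IsProbabilityMeasure μ] (hU_meas : ∀ n, Measurable (U n))
    (hU_indep : iIndepFun U μ)
    (hU_unif : ∀ n, pdf.IsUniform (U n) (Set.Icc 0 1) μ volume) (n : ℕ) :
    μ.map (fun ω (i : Fin n) => U i ω) =
      (volume : Measure (Fin n → ℝ)).restrict (Set.univ.pi fun _ => Set.Icc 0 1) := by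
  have h1 : ∀ k, μ.map (U k) = volume.restrict (Set.Icc 0 1) := by
    intro k
    rw [hU_unif k, ProbabilityTheory.cond]
    simp
  have h2 : iIndepFun (fun i : Fin n => U i) μ := hU_indep.precomp Fin.val_injective
  rw [(iIndepFun_iff_map_fun_eq_pi_map fun i : Fin n => (hU_meas i).aemeasurable).1 h2]
  simp_rw [h1]
  rw [volume_pi, Measure.restrict_pi_pi]

theorem measure_preimage_eq_volume [IsProbabilityMeasure μ] (hU_meas : ∀ n, Measurable (U n))
    (hU_indep : iIndepFun U μ)
    (hU_unif : ∀ n, pdf.IsUniform (U n) (Set.Icc 0 1) μ volume) (n : ℕ)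
    {S : Set (Fin n → ℝ)} (hS : MeasurableSet S) :
    μ {ω | (fun i : Fin n => U i ω) ∈ S} =
      volume {x : Fin n → ℝ | (∀ i, x i ∈ Set.Icc (0 : ℝ) 1) ∧ x ∈ S} := by
  have hm : Measurable fun ω (i : Fin n) => U i ω := measurable_pi_lambda _ fun i => hU_meas i
  have := Measure.map_apply hm hS (μ := μ)
  rw [map_uniform_eq_restrict_cube hU_meas hU_indep hU_unif, Measure.restrict_apply hS] at this
  refine Eq.trans this.symm ?_
  congr 1
  ext x
  simp only [Set.mem_inter_iff, Set.mem_univ_pi, Set.mem_ofPred_eq]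
  exact and_comm

theorem measure_coe_lt_breaksUntilTriangle_le [IsProbabilityMeasure μ]
    (hU_meas : ∀ n, Measurable (U n)) (hU_indep : iIndepFun U μ)
    (hU_unif : ∀ n, pdf.IsUniform (U n) (Set.Icc 0 1) μ volume) (m : ℕ) :
    μ {ω | (m : ℕ∞) < breaksUntilTriangle (fun n => U n ω)} ≤
      ENNReal.ofReal (noTriangleProb m) := by
  refine le_trans ?_ (volume_no_triangle_le m)
  refine le_trans (measure_mono ?_) (measure_preimage_eq_volume hU_meas hU_indep hU_unif m
    (measurableSet_someThreeFormTriangle m).compl).le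
  intro ω hω
  exact (coe_lt_breaksUntilTriangle_iff _ m).1 hω m le_rfl

theorem measure_three_lt_breaksUntilTriangle_le [IsProbabilityMeasure μ]
    (hU_meas : ∀ n, Measurable (U n)) (hU_indep : iIndepFun U μ)
    (hU_unif : ∀ n, pdf.IsUniform (U n) (Set.Icc 0 1) μ volume) :
    μ {ω | ((3 : ℕ) : ℕ∞) < breaksUntilTriangle (fun n => U n ω)} ≤
      ENNReal.ofReal (45 / 112) := by
  refine le_trans ?_ volume_no_triangle_two_three_le
  have hproj : Measurable fun (x : Fin 3 → ℝ) (i : Fin 2) => x i.castSucc :=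
    measurable_pi_lambda _ fun i => measurable_pi_apply i.castSucc
  refine le_trans (measure_mono ?_) (measure_preimage_eq_volume hU_meas hU_indep hU_unif 3
    ((measurableSet_someThreeFormTriangle 3).compl.inter
      (hproj (measurableSet_someThreeFormTriangle 2)).compl)).le
  intro ω hω
  have h := (coe_lt_breaksUntilTriangle_iff _ 3).1 hω
  exact ⟨h 3 le_rfl, h 2 (by norm_num)⟩

end

/-! ### Numerical estimates and conclusion. -/

theorem noTriangleProb_nonneg (n : ℕ) : 0 ≤ noTriangleProb n :=
  div_nonneg (by positivity) (Finset.prod_nonneg fun j _ =>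
    (sub_pos.2 (one_lt_fib_add_three j)).le)

theorem noTriangleProb_succ (n : ℕ) :
    noTriangleProb (n + 1) = noTriangleProb n * ((n + 2) / ((Nat.fib (n + 4) : ℝ) - 1)) := by
  rw [noTriangleProb, noTriangleProb, Finset.prod_range_succ _ (n + 1), Nat.factorial_succ (n + 1),
    div_mul_div_comm]
  push_cast
  ring_nf

/-- Exactly what makes the ratio (m + 10) / (F_{m+12} - 1) of consecutive bounds from index 8 on at
most 1/2. -/
theorem linear_le_fib (m : ℕ) : 2 * m + 21 ≤ Nat.fib (m + 12) := by
  induction m with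
  | zero => decide
  | succ m ih =>
    have h : Nat.fib (m + 1 + 12) = Nat.fib (m + 11) + Nat.fib (m + 12) := Nat.fib_add_two
    have h' : Nat.fib 3 ≤ Nat.fib (m + 11) := Nat.fib_mono (by omega)
    have h3 : Nat.fib 3 = 2 := rfl
    omega

theorem noTriangleProb_add_eight_le (m : ℕ) :
    noTriangleProb (m + 8) ≤ noTriangleProb 8 * (1 / 2) ^ m := by
  induction m with
  | zero => simp
  | succ m ih =>
    have hf : ((2 * m + 21 : ℕ) : ℝ) ≤ Nat.fib (m + 12) := by exact_mod_cast linear_le_fib m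
    push_cast at hf
    have e : m + 1 + 8 = (m + 8) + 1 := by ring
    rw [e, noTriangleProb_succ, pow_succ, ← mul_assoc]
    have hm : (0 : ℝ) ≤ m := m.cast_nonneg
    refine mul_le_mul ih ?_ ?_ ((noTriangleProb_nonneg _).trans ih)
    · rw [div_le_iff₀ (by linarith)]
      push_cast
      linarith
    · exact div_nonneg (by positivity) (by linarith)

theorem mainTheorem11 {Ω : Type*} [MeasurableSpace Ω] (μ : Measure Ω) [IsProbabilityMeasure μ]
    (U : ℕ → Ω → ℝ) (hU_meas : ∀ n, Measurable (U n)) (hU_indep : iIndepFun U μ)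
    (hU_unif : ∀ n, pdf.IsUniform (U n) (Set.Icc 0 1) μ volume) :
    Measurable (fun ω => breaksUntilTriangle (fun n => U n ω)) ∧
      ∫⁻ ω, (breaksUntilTriangle (fun n => U n ω) : ENNReal) ∂μ ≤ ENNReal.ofReal 3.398 := by
  refine ⟨measurable_breaksUntilTriangle hU_meas, ?_⟩
  rw [lintegral_breaksUntilTriangle hU_meas]
  set a : ℕ → ENNReal := fun m => μ {ω | (m : ℕ∞) < breaksUntilTriangle (fun n => U n ω)} with ha
  have hle : ∀ m, a m ≤ ENNReal.ofReal (noTriangleProb m) :=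
    measure_coe_lt_breaksUntilTriangle_le hU_meas hU_indep hU_unif
  have h3 : a 3 ≤ ENNReal.ofReal (45 / 112) :=
    measure_three_lt_breaksUntilTriangle_le hU_meas hU_indep hU_unif
  have htail : ∑' m, a (m + 8) ≤ ENNReal.ofReal (noTriangleProb 8 * 2) := by
    have hs : Summable fun m : ℕ => noTriangleProb 8 * (1 / 2 : ℝ) ^ m :=
      summable_geometric_two.mul_left _
    rw [← tsum_geometric_two, ← tsum_mul_left, ENNReal.ofReal_tsum_of_nonneg (fun m =>
      mul_nonneg (noTriangleProb_nonneg _) (by positivity)) hs]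
    exact ENNReal.tsum_le_tsum fun m => (hle _).trans
      (ENNReal.ofReal_le_ofReal (noTriangleProb_add_eight_le m))
  have hvals : noTriangleProb 0 = 1 ∧ noTriangleProb 1 = 1 ∧ noTriangleProb 2 = 3 / 4 ∧
      noTriangleProb 4 = 5 / 28 ∧ noTriangleProb 5 = 3 / 56 ∧ noTriangleProb 6 = 1 / 88 ∧
      noTriangleProb 7 = 1 / 594 ∧ noTriangleProb 8 = 1 / 5808 := by
    refine ⟨?_, ?_, ?_, ?_, ?_, ?_, ?_, ?_⟩ <;>
      norm_num [noTriangleProb, Finset.prod_range_succ, Nat.factorial, Nat.fib_add_two]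
  obtain ⟨p0, p1, p2, p4, p5, p6, p7, p8⟩ := hvals
  have h0 := hle 0
  have h1 := hle 1
  have h2 := hle 2
  have h4 := hle 4
  have h5 := hle 5
  have h6 := hle 6
  have h7 := hle 7
  rw [p0] at h0
  rw [p1] at h1
  rw [p2] at h2
  rw [p4] at h4
  rw [p5] at h5
  rw [p6] at h6
  rw [p7] at h7
  rw [p8] at htail
  -- The total is 1 + 1 + 3/4 + 45/112 + 5/28 + 3/56 + 1/88 + 1/594 + 2/5808, about 3.3973.
  rw [← Summable.sum_add_tsum_nat_add' (k := 8) ENNReal.summable]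
  simp only [Finset.sum_range_succ, Finset.sum_range_zero, zero_add]
  refine (add_le_add (add_le_add (add_le_add (add_le_add (add_le_add (add_le_add (add_le_add
    (add_le_add h0 h1) h2) h3) h4) h5) h6) h7) htail).trans ?_
  rw [← ENNReal.ofReal_add, ← ENNReal.ofReal_add, ← ENNReal.ofReal_add, ← ENNReal.ofReal_add,
    ← ENNReal.ofReal_add, ← ENNReal.ofReal_add, ← ENNReal.ofReal_add, ← ENNReal.ofReal_add]
  · exact ENNReal.ofReal_le_ofReal (by norm_num)
  all_goals norm_num
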